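/- Let $q,a,b$ be complex numbers with $0<|q|<1$, and put $$(x;q)_\infty=\prod_{i\ge 0}(1-xq^i),\qquad (x;q)_n=\prod_{i=0}^{n-1}(1-xq^i),\qquad (x_1,\dots,x_r;q)_n=(x_1;q)_n\cdots(x_r;q)_n\quad(0\le n\le\infty),$$ $$\theta(q,x)=\sum_{n=0}^{\infty}(-1)^nq^{\binom n2}x^n,\qquad S(a,b)=(q,a,b;q)_\infty\sum_{n=0}^{\infty}\frac{(ab/q^3;q)_{2n}}{(q,a,b,ab/q^3;q)_n}\,q^{2n}.$$ Assume that no denominator below or in $S(a,b)$ vanishes, that is, $a\ne0$, $b\ne0$, $a\ne bq$, $b\ne aq$, and $aq^n\ne1$, $bq^n\ne1$, $(ab/q^3)q^n\ne1$ for every integer $n\ge0$. Then the series for $\theta(q,a)$, $\theta(q,b)$ and the series in $S(a,b)$ converge absolutely, and $$\frac{ab-a^2q-aq^2+bq^3}{b(a-bq)(b-aq)}\,\theta(q,a)-\frac{ab-b^2q-bq^2+aq^3}{a(a-bq)(b-aq)}\,\theta(q,b)+\frac{q^2(a^2-b^2)}{ab(a-bq)(b-aq)}=\frac{a-b}{ab}\,S(a,b).$$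 -/

import Mathlib

namespace PartialTheta

/-- The finite `q`-shifted factorial `(x; q)_n = (1 - x)(1 - x q) ⋯ (1 - x q ^ (n - 1))`. -/
noncomputable def qPoch (x q : ℂ) (n : ℕ) : ℂ :=
  ∏ i ∈ Finset.range n, (1 - x * q ^ i)

/-- The infinite `q`-shifted factorial `(x; q)_∞ = ∏_{i ≥ 0} (1 - x q ^ i)`. -/
noncomputable def qPochInf (x q : ℂ) : ℂ :=
  ∏' i : ℕ, (1 - x * q ^ i)

/-- The factors of `(x; q)_∞` form a convergent product whenever `|q| < 1`. -/
theorem multipliable_qPochInf (x : ℂ) {q : ℂ} (hq : ‖q‖ < 1) :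
    Multipliable (fun i : ℕ => 1 - x * q ^ i) := by
  have h : Summable (fun i : ℕ => ‖-(x * q ^ i)‖) := by
    simp only [norm_neg, norm_mul, norm_pow]
    exact (summable_geometric_of_lt_one (norm_nonneg q) hq).mul_left _
  simpa [sub_eq_add_neg] using multipliable_one_add_of_summable h

/-- The product `(x; q)_∞` vanishes only if one of its factors does. -/
theorem qPochInf_ne_zero {x q : ℂ} (hq : ‖q‖ < 1) (hx : ∀ i : ℕ, x * q ^ i ≠ 1) :
    qPochInf x q ≠ 0 := by
  have h : Summable (fun i : ℕ => ‖-(x * q ^ i)‖) := by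
    simp only [norm_neg, norm_mul, norm_pow]
    exact (summable_geometric_of_lt_one (norm_nonneg q) hq).mul_left _
  have := tprod_one_add_ne_zero_of_summable (f := fun i : ℕ => -(x * q ^ i))
    (fun i => by
      rw [← sub_eq_add_neg]
      exact sub_ne_zero.mpr (hx i).symm) h
  simpa [qPochInf, sub_eq_add_neg] using this

/-- The finite factorial is the quotient `(x; q)_n = (x; q)_∞ / (x q ^ n; q)_∞` wherever the
quotient is defined. -/
theorem qPoch_eq_div {x q : ℂ} (hq : ‖q‖ < 1) (n : ℕ)
    (hx : ∀ i : ℕ, x * q ^ n * q ^ i ≠ 1) :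
    qPoch x q n = qPochInf x q / qPochInf (x * q ^ n) q := by
  rw [eq_div_iff (qPochInf_ne_zero hq hx)]
  have hm := (multipliable_qPochInf (x * q ^ n) hq).hasProd
  have hshift : (fun i : ℕ => 1 - x * q ^ n * q ^ i) =
      fun i : ℕ => (fun j : ℕ => 1 - x * q ^ j) (i + n) := by
    funext i
    simp only [pow_add]
    ring
  have key : HasProd (fun j : ℕ => 1 - x * q ^ j) (qPoch x q n * qPochInf (x * q ^ n) q) :=
    HasProd.prod_range_mul (f := fun j : ℕ => 1 - x * q ^ j) (k := n)
      (m := qPochInf (x * q ^ n) q) (by rw [← hshift]; exact hm)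
  exact key.tprod_eq.symm

/-- The terms of the partial theta function `θ(q, x)`. -/
noncomputable def thetaTerm (q x : ℂ) (n : ℕ) : ℂ :=
  (-1) ^ n * q ^ (n.choose 2) * x ^ n

/-- The partial theta function `θ(q, x) = ∑_{n ≥ 0} (-1) ^ n q ^ (n choose 2) x ^ n`. -/
noncomputable def theta (q x : ℂ) : ℂ :=
  ∑' n : ℕ, thetaTerm q x n

/-- The terms
`(ab / q³; q)_{2n} / ((q; q)_n (a; q)_n (b; q)_n (ab / q³; q)_n) * q ^ (2n)`
of the series in `S(a, b)`. -/
noncomputable def STerm (q a b : ℂ) (n : ℕ) : ℂ :=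
  qPoch (a * b / q ^ 3) q (2 * n) /
    (qPoch q q n * qPoch a q n * qPoch b q n * qPoch (a * b / q ^ 3) q n) * q ^ (2 * n)

/-- `S(a, b) = (q; q)_∞ (a; q)_∞ (b; q)_∞ ∑_{n ≥ 0} STerm q a b n`. -/
noncomputable def S (q a b : ℂ) : ℂ :=
  qPochInf q q * qPochInf a q * qPochInf b q * ∑' n : ℕ, STerm q a b n

end PartialTheta

namespace PartialTheta

open Filter Topology

/-! ### Shifted factorials -/

/-! The engine is the Andrews–Warnaar formula `prodSum_eq_theta_mul_theta`. Both of its sides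
satisfy F(a,b) + aF(aq,b) + bF(a,bq) + abF(aq,bq) = 1: the product because θ(x) + xθ(xq) = 1, the
series because its partial sums telescope (`sum_prodTerm`). Boundedness along a q^m makes the
solution unique (`eq_zero_of_eq_neg_mul`).

The formula is applied at (a/q, b/q), (a/q², b) and (a, b/q²). All three share the factor
(abq^(n-3); q)_n, so each series is a combination of the same three sums, with weights q^n, q^(2n),
q^(3n). Eliminating the first and third leaves S(a,b). Absorbing the infinite products into
`prodTerm` removes all denominators, so the shifted parameters need no nonvanishing conditions. -/

theorem qPoch_succ (x q : ℂ) (n : ℕ) :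
    qPoch x q (n + 1) = qPoch x q n * (1 - x * q ^ n) :=
  Finset.prod_range_succ _ _

theorem qPoch_succ_left {x y q : ℂ} (h : y = x * q) (n : ℕ) :
    qPoch x q (n + 1) = (1 - x) * qPoch y q n := by
  subst h
  simp only [qPoch, Finset.prod_range_succ', pow_zero, mul_one, pow_succ]
  rw [mul_comm]
  congr 1
  exact Finset.prod_congr rfl fun i _ => by ring

theorem qPoch_add (x q : ℂ) (m n : ℕ) :
    qPoch x q (m + n) = qPoch x q m * qPoch (x * q ^ m) q n := by
  simp only [qPoch, Finset.prod_range_add, pow_add, mul_assoc]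

theorem qPoch_ne_zero {x q : ℂ} (hx : ∀ i : ℕ, x * q ^ i ≠ 1) (n : ℕ) : qPoch x q n ≠ 0 :=
  Finset.prod_ne_zero_iff.mpr fun i _ => sub_ne_zero.mpr (hx i).symm

theorem qPochInf_eq_qPoch_mul (x : ℂ) {q : ℂ} (hq : ‖q‖ < 1) (n : ℕ) :
    qPochInf x q = qPoch x q n * qPochInf (x * q ^ n) q := by
  have hm := (multipliable_qPochInf (x * q ^ n) hq).hasProd
  have hshift : (fun i : ℕ => 1 - x * q ^ n * q ^ i) =
      fun i : ℕ => (fun j : ℕ => 1 - x * q ^ j) (i + n) := by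
    funext i
    simp only [pow_add]
    ring
  have key : HasProd (fun j : ℕ => 1 - x * q ^ j) (qPoch x q n * qPochInf (x * q ^ n) q) :=
    HasProd.prod_range_mul (f := fun j : ℕ => 1 - x * q ^ j) (k := n)
      (m := qPochInf (x * q ^ n) q) (by rw [← hshift]; exact hm)
  exact key.tprod_eq

theorem qPochInf_step {x y q : ℂ} (hq : ‖q‖ < 1) (h : y = x * q) :
    qPochInf x q = (1 - x) * qPochInf y q := by
  have := qPochInf_eq_qPoch_mul x hq 1
  rw [pow_one, ← h] at this
  simpa [qPoch] using this

/-- The bound is uniform in n, so it passes to the infinite product and also handles (xq^n; q)_n,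
whose length grows with its argument. -/
theorem norm_qPoch_sub_one_le (x : ℂ) {q : ℂ} (hq : ‖q‖ < 1) (n : ℕ) :
    ‖qPoch x q n - 1‖ ≤ Real.exp (‖x‖ / (1 - ‖q‖)) - 1 := by
  have h := Finset.norm_prod_one_add_sub_one_le (Finset.range n) (fun i => -(x * q ^ i))
  simp only [← sub_eq_add_neg, norm_neg, norm_mul, norm_pow] at h
  refine h.trans (sub_le_sub_right (Real.exp_le_exp.mpr ?_) 1)
  have hs := summable_geometric_of_lt_one (norm_nonneg q) hq
  rw [← Finset.mul_sum, div_eq_mul_inv, ← tsum_geometric_of_lt_one (norm_nonneg q) hq]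
  exact mul_le_mul_of_nonneg_left
    (hs.sum_le_tsum _ fun i _ => pow_nonneg (norm_nonneg q) i) (norm_nonneg x)

theorem norm_qPochInf_sub_one_le (x : ℂ) {q : ℂ} (hq : ‖q‖ < 1) :
    ‖qPochInf x q - 1‖ ≤ Real.exp (‖x‖ / (1 - ‖q‖)) - 1 := by
  have h : Tendsto (qPoch x q) atTop (𝓝 (qPochInf x q)) :=
    (multipliable_qPochInf x hq).hasProd.tendsto_prod_nat
  exact le_of_tendsto (h.sub_const 1).norm
    (Eventually.of_forall (norm_qPoch_sub_one_le x hq))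

theorem norm_le_exp_of_norm_sub_one_le {z : ℂ} {t s : ℝ} (h : ‖z - 1‖ ≤ Real.exp t - 1)
    (hts : t ≤ s) : ‖z‖ ≤ Real.exp s := by
  have h1 : ‖z‖ ≤ ‖z - 1‖ + ‖(1 : ℂ)‖ := by simpa using norm_add_le (z - 1) 1
  rw [norm_one] at h1
  linarith [Real.exp_le_exp.mpr hts]

theorem norm_mul_pow_le (x : ℂ) {q : ℂ} (hq : ‖q‖ < 1) (n : ℕ) : ‖x * q ^ n‖ ≤ ‖x‖ := by
  rw [norm_mul, norm_pow]
  exact mul_le_of_le_one_right (norm_nonneg x) (pow_le_one₀ (norm_nonneg q) hq.le)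

theorem norm_qPoch_le {x q : ℂ} {R : ℝ} (hq : ‖q‖ < 1) (hx : ‖x‖ ≤ R) (n : ℕ) :
    ‖qPoch x q n‖ ≤ Real.exp (R / (1 - ‖q‖)) :=
  norm_le_exp_of_norm_sub_one_le (norm_qPoch_sub_one_le x hq n)
    (div_le_div_of_nonneg_right hx (sub_nonneg.mpr hq.le))

theorem norm_qPochInf_le {x q : ℂ} {R : ℝ} (hq : ‖q‖ < 1) (hx : ‖x‖ ≤ R) :
    ‖qPochInf x q‖ ≤ Real.exp (R / (1 - ‖q‖)) :=
  norm_le_exp_of_norm_sub_one_le (norm_qPochInf_sub_one_le x hq)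
    (div_le_div_of_nonneg_right hx (sub_nonneg.mpr hq.le))

theorem tendsto_one_of_norm_sub_one_le {f : ℕ → ℂ} {x q : ℂ} (hq : ‖q‖ < 1)
    (h : ∀ n, ‖f n - 1‖ ≤ Real.exp (‖x * q ^ n‖ / (1 - ‖q‖)) - 1) :
    Tendsto f atTop (𝓝 1) := by
  rw [tendsto_iff_norm_sub_tendsto_zero]
  refine squeeze_zero (fun n => norm_nonneg _) h ?_
  have h1 : Tendsto (fun n : ℕ => x * q ^ n) atTop (𝓝 0) := by
    simpa using (tendsto_pow_atTop_nhds_zero_of_norm_lt_one hq).const_mul x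
  have h2 := ((Real.continuous_exp.tendsto _).comp (h1.norm.div_const (1 - ‖q‖))).sub_const 1
  simpa using h2

theorem tendsto_qPochInf_mul_pow (x : ℂ) {q : ℂ} (hq : ‖q‖ < 1) :
    Tendsto (fun n : ℕ => qPochInf (x * q ^ n) q) atTop (𝓝 1) :=
  tendsto_one_of_norm_sub_one_le hq fun n => norm_qPochInf_sub_one_le (x * q ^ n) hq

theorem tendsto_qPoch_mul_pow (x : ℂ) {q : ℂ} (hq : ‖q‖ < 1) :
    Tendsto (fun n : ℕ => qPoch (x * q ^ n) q n) atTop (𝓝 1) :=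
  tendsto_one_of_norm_sub_one_le hq fun n => norm_qPoch_sub_one_le (x * q ^ n) hq n

/-! ### The partial theta function -/

theorem thetaTerm_succ (q x : ℂ) (n : ℕ) :
    thetaTerm q x (n + 1) = -(x * q ^ n) * thetaTerm q x n := by
  simp only [thetaTerm, Nat.choose_succ_succ' n 1, Nat.choose_one_right, pow_add]
  ring

theorem thetaTerm_succ' (q x : ℂ) (n : ℕ) :
    thetaTerm q x (n + 1) = -x * thetaTerm q (x * q) n := by
  simp only [thetaTerm, Nat.choose_succ_succ' n 1, Nat.choose_one_right, pow_add, mul_pow]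
  ring

theorem summable_thetaTerm {q : ℂ} (hq : ‖q‖ < 1) (x : ℂ) : Summable (thetaTerm q x) := by
  have h1 : Tendsto (fun n : ℕ => ‖x * q ^ n‖) atTop (𝓝 0) := by
    simpa using ((tendsto_pow_atTop_nhds_zero_of_norm_lt_one hq).const_mul x).norm
  refine summable_of_ratio_norm_eventually_le (r := 1 / 2) (by norm_num) ?_
  filter_upwards [h1.eventually_le_const (show (0 : ℝ) < 1 / 2 by norm_num)] with n hn
  rw [thetaTerm_succ, norm_mul, norm_neg]
  exact mul_le_mul_of_nonneg_right hn (norm_nonneg _)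

theorem theta_eq_one_sub {q : ℂ} (hq : ‖q‖ < 1) (x : ℂ) :
    theta q x = 1 - x * theta q (x * q) := by
  rw [theta, (summable_thetaTerm hq x).tsum_eq_zero_add]
  simp only [thetaTerm_succ', tsum_mul_left, theta]
  simp [thetaTerm]
  ring

theorem norm_theta_mul_pow_le {q : ℂ} (hq : ‖q‖ < 1) (x : ℂ) (m : ℕ) :
    ‖theta q (x * q ^ m)‖ ≤ ∑' n, ‖thetaTerm q x n‖ := by
  refine tsum_of_norm_bounded (summable_thetaTerm hq x).norm.hasSum fun n => ?_
  simp only [thetaTerm, norm_mul ((-1 : ℂ) ^ n * _), norm_pow (x * q ^ m), norm_pow x]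
  gcongr
  exact norm_mul_pow_le x hq m

/-- A function with `f a = -a f (a q)` that is bounded on `{a q ^ m}` vanishes at `a`. -/
theorem eq_zero_of_eq_neg_mul {q : ℂ} (hq : ‖q‖ < 1) {f : ℂ → ℂ}
    (hf : ∀ a, f a = -a * f (a * q)) {a : ℂ} {K : ℝ} (hK : ∀ m : ℕ, ‖f (a * q ^ m)‖ ≤ K) :
    f a = 0 := by
  -- Iterating the equation m times accumulates ∏(-a q^i), which is exactly `thetaTerm q a m` and
  -- tends to 0.
  have h : ∀ m : ℕ, f a = thetaTerm q a m * f (a * q ^ m) := by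
    intro m
    induction m with
    | zero => simp [thetaTerm]
    | succ m ih =>
      rw [ih, thetaTerm_succ, hf (a * q ^ m), pow_succ, ← mul_assoc a]
      ring
  have h0 : Tendsto (fun m => ‖thetaTerm q a m‖ * K) atTop (𝓝 0) := by
    simpa using (summable_thetaTerm hq a).tendsto_atTop_zero.norm.mul_const K
  have hle : ‖f a‖ ≤ 0 := by
    refine ge_of_tendsto h0 (Eventually.of_forall fun m => ?_)
    rw [h m, norm_mul]
    exact mul_le_mul_of_nonneg_left (hK m) (norm_nonneg _)
  exact norm_le_zero_iff.mp hle

/-! ### The product of two partial theta functions -/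

/-- The terms `(q ^ (n + 1), a q ^ n, b q ^ n; q)_∞ (c q ^ n; q)_n z ^ n`. -/
noncomputable def prodTerm (q a b c z : ℂ) (n : ℕ) : ℂ :=
  qPochInf (q * q ^ n) q * qPochInf (a * q ^ n) q * qPochInf (b * q ^ n) q *
    qPoch (c * q ^ n) q n * z ^ n

theorem norm_prodTerm_le {q : ℂ} (hq : ‖q‖ < 1) {a b c : ℂ} (z : ℂ) {A B C : ℝ}
    (ha : ‖a‖ ≤ A) (hb : ‖b‖ ≤ B) (hc : ‖c‖ ≤ C) (n : ℕ) :
    ‖prodTerm q a b c z n‖ ≤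
      Real.exp (‖q‖ / (1 - ‖q‖)) * Real.exp (A / (1 - ‖q‖)) * Real.exp (B / (1 - ‖q‖)) *
        Real.exp (C / (1 - ‖q‖)) * ‖z‖ ^ n := by
  simp only [prodTerm, norm_mul, norm_pow]
  gcongr
  · exact norm_qPochInf_le hq (norm_mul_pow_le q hq n)
  · exact norm_qPochInf_le hq ((norm_mul_pow_le a hq n).trans ha)
  · exact norm_qPochInf_le hq ((norm_mul_pow_le b hq n).trans hb)
  · exact norm_qPoch_le hq ((norm_mul_pow_le c hq n).trans hc) n

theorem summable_prodTerm {q : ℂ} (hq : ‖q‖ < 1) (a b c : ℂ) {z : ℂ} (hz : ‖z‖ < 1) :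
    Summable (prodTerm q a b c z) :=
  Summable.of_norm_bounded ((summable_geometric_of_lt_one (norm_nonneg z) hz).mul_left _)
    (norm_prodTerm_le hq z le_rfl le_rfl le_rfl)

/-- The series `(q, a, b; q)_∞ ∑ (a b q ^ (n - 1); q)_n q ^ n / (q, a, b; q)_n`. -/
noncomputable def prodSum (q a b : ℂ) : ℂ :=
  ∑' n, prodTerm q a b (a * b / q) q n

theorem prodSum_comm (q a b : ℂ) : prodSum q a b = prodSum q b a := by
  simp only [prodSum, prodTerm]
  exact tsum_congr fun n => by rw [mul_comm a b]; ring

theorem exists_norm_prodSum_le {q : ℂ} (hq : ‖q‖ < 1) (a b : ℂ) :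
    ∃ K, ∀ m : ℕ, ‖prodSum q (a * q ^ m) b‖ ≤ K := by
  refine ⟨_, fun m => tsum_of_norm_bounded
    ((summable_geometric_of_lt_one (norm_nonneg q) hq).mul_left _).hasSum
    (norm_prodTerm_le hq q (norm_mul_pow_le a hq m) le_rfl
      (show ‖a * q ^ m * b / q‖ ≤ ‖a * b / q‖ from ?_))⟩
  rw [show a * q ^ m * b / q = a * b / q * q ^ m by ring]
  exact norm_mul_pow_le _ hq m

/-- Telescoping: the combined term of index n + 1 is the difference of consecutive values of the
closed form, whose limit is 1. -/
theorem sum_prodTerm {q : ℂ} (hq0 : q ≠ 0) (hq : ‖q‖ < 1) (a b : ℂ) (n : ℕ) :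
    ∑ i ∈ Finset.range (n + 1),
      (prodTerm q a b (a * b / q) q i + a * prodTerm q (a * q) b (a * q * b / q) q i
        + b * prodTerm q a (b * q) (a * (b * q) / q) q i
        + a * b * prodTerm q (a * q) (b * q) (a * q * (b * q) / q) q i) =
    qPochInf (q * q ^ n) q * qPochInf (a * q ^ (n + 1)) q * qPochInf (b * q ^ (n + 1)) q *
      qPoch (a * b * q * q ^ n) q n := by
  have hI : ∀ (x : ℂ) (k : ℕ),
      qPochInf (x * q ^ k) q = (1 - x * q ^ k) * qPochInf (x * q ^ (k + 1)) q :=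
    fun x k => qPochInf_step hq (by ring)
  have hS : ∀ (x : ℂ) (k : ℕ), qPochInf (x * q * q ^ k) q = qPochInf (x * q ^ (k + 1)) q :=
    fun x k => by congr 1; ring
  have c1 : a * q * b / q = a * b := by field_simp
  have c2 : a * (b * q) / q = a * b := by field_simp
  have c3 : a * q * (b * q) / q = a * b * q := by field_simp
  have hd : q / q = 1 := div_self hq0
  induction n with
  | zero =>
    simp only [zero_add, Finset.sum_range_one, prodTerm, hS, hI a 0, hI b 0]
    simp [qPoch]
    ring
  | succ n ih =>
    rw [Finset.sum_range_succ, ih]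
    simp only [prodTerm, hS, c1, c2, c3, hI a (n + 1), hI b (n + 1), hI q n]
    -- Extracting the common factor (abq^(n+3); q)_n strips two factors from a symbol that has only
    -- one in the first case.
    rcases n with _ | n
    · simp only [qPoch, zero_add, Finset.prod_range_one, Finset.prod_range_zero, pow_zero,
        pow_one, mul_one, div_mul_cancel₀ _ hq0]
      ring
    · have e1 : qPoch (a * b / q * q ^ (n + 1 + 1)) q (n + 1 + 1) =
          (1 - a * b * q ^ (n + 1)) * ((1 - a * b * q ^ (n + 2)) *
            qPoch (a * b * q ^ (n + 3)) q n) := by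
        rw [show a * b / q * q ^ (n + 1 + 1) = a * b * q ^ (n + 1) by
            rw [pow_succ q (n + 1)]; field_simp,
          qPoch_succ_left (y := a * b * q ^ (n + 2)) (by ring),
          qPoch_succ_left (y := a * b * q ^ (n + 3)) (by ring)]
      have e2 : qPoch (a * b * q ^ (n + 1 + 1)) q (n + 1 + 1) =
          (1 - a * b * q ^ (n + 2)) * (qPoch (a * b * q ^ (n + 3)) q n *
            (1 - a * b * q ^ (n + 3) * q ^ n)) := by
        rw [qPoch_succ_left (y := a * b * q ^ (n + 3)) (by ring), qPoch_succ]
      have e3 : qPoch (a * b * q * q ^ (n + 1 + 1)) q (n + 1 + 1) =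
          qPoch (a * b * q ^ (n + 3)) q n * (1 - a * b * q ^ (n + 3) * q ^ n) *
            (1 - a * b * q ^ (n + 3) * q ^ (n + 1)) := by
        rw [show a * b * q * q ^ (n + 1 + 1) = a * b * q ^ (n + 3) by ring, qPoch_succ,
          qPoch_succ]
      have e4 : qPoch (a * b * q * q ^ (n + 1)) q (n + 1) =
          (1 - a * b * q ^ (n + 2)) * qPoch (a * b * q ^ (n + 3)) q n := by
        rw [show a * b * q * q ^ (n + 1) = a * b * q ^ (n + 2) by ring,
          qPoch_succ_left (y := a * b * q ^ (n + 3)) (by ring)]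
      rw [e1, e2, e3, e4]
      generalize qPoch (a * b * q ^ (n + 3)) q n = C
      generalize qPochInf (q * q ^ (n + 1 + 1)) q = X
      generalize qPochInf (a * q ^ (n + 1 + 1 + 1)) q = Y
      generalize qPochInf (b * q ^ (n + 1 + 1 + 1)) q = Z
      ring

theorem prodSum_functional_eq {q : ℂ} (hq0 : q ≠ 0) (hq : ‖q‖ < 1) (a b : ℂ) :
    prodSum q a b + a * prodSum q (a * q) b + b * prodSum q a (b * q)
      + a * b * prodSum q (a * q) (b * q) = 1 := by
  have hs := fun a b c : ℂ => (summable_prodTerm hq a b c hq).hasSum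
  have h1 := ((((hs a b (a * b / q)).add ((hs (a * q) b (a * q * b / q)).mul_left a)).add
    ((hs a (b * q) (a * (b * q) / q)).mul_left b)).add
    ((hs (a * q) (b * q) (a * q * (b * q) / q)).mul_left (a * b))).tendsto_sum_nat
  have h2 := h1.comp (tendsto_add_atTop_nat 1)
  refine tendsto_nhds_unique (h2.congr fun n => sum_prodTerm hq0 hq a b n) ?_
  have hI := fun x : ℂ => (tendsto_qPochInf_mul_pow x hq).comp (tendsto_add_atTop_nat 1)
  simpa using (((tendsto_qPochInf_mul_pow q hq).mul (hI a)).mul (hI b)).mul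
    (tendsto_qPoch_mul_pow (a * b * q) hq)

/-- The Andrews–Warnaar product formula. -/
theorem prodSum_eq_theta_mul_theta {q : ℂ} (hq0 : q ≠ 0) (hq : ‖q‖ < 1) (a b : ℂ) :
    prodSum q a b = theta q a * theta q b := by
  let D : ℂ → ℂ → ℂ := fun a b => prodSum q a b - theta q a * theta q b
  have hDcomm : ∀ a b, D a b = D b a := fun a b => by
    simp only [D, prodSum_comm q a b, mul_comm]
  have hD : ∀ a b, ∃ K, ∀ m : ℕ, ‖D (a * q ^ m) b‖ ≤ K := by
    intro a b
    obtain ⟨K, hK⟩ := exists_norm_prodSum_le hq a b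
    refine ⟨K + (∑' n, ‖thetaTerm q a n‖) * ‖theta q b‖, fun m => ?_⟩
    refine (norm_sub_le _ _).trans (add_le_add (hK m) ?_)
    rw [norm_mul]
    exact mul_le_mul_of_nonneg_right (norm_theta_mul_pow_le hq a m) (norm_nonneg _)
  -- The homogeneous equation factors as E(a) + aE(aq) = 0 with E(a) = D(a,b) + bD(a,bq), so
  -- uniqueness is used once in a and then once in b.
  have hE : ∀ a b, D a b + b * D a (b * q) = 0 := by
    intro a b
    obtain ⟨K, hK⟩ := hD a b
    obtain ⟨L, hL⟩ := hD a (b * q)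
    refine eq_zero_of_eq_neg_mul hq (f := fun a => D a b + b * D a (b * q))
      (K := K + ‖b‖ * L) (fun a => ?_) fun m => ?_
    · simp only [D]
      rw [theta_eq_one_sub hq a, theta_eq_one_sub hq b]
      linear_combination prodSum_functional_eq hq0 hq a b
    · refine (norm_add_le _ _).trans (add_le_add (hK m) ?_)
      rw [norm_mul]
      exact mul_le_mul_of_nonneg_left (hL m) (norm_nonneg b)
  obtain ⟨K, hK⟩ := hD b a
  refine sub_eq_zero.mp (eq_zero_of_eq_neg_mul hq (f := fun b => D a b) (K := K)
    (fun b => by linear_combination hE a b) fun m => ?_)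
  rw [hDcomm]
  exact hK m

/-! ### Contiguous relations -/

/-- Shifting the parameters of `prodSum` down by powers of `q` expresses it through the series
with `(c q ^ n; q)_n` and the weights `q ^ n`, `q ^ (2 n)`, `q ^ (3 n)`. -/
theorem prodSum_eq_add_add {q : ℂ} (hq : ‖q‖ < 1) {a b c a' b' u v : ℂ}
    (hc : a' * b' / q = c)
    (h : ∀ n : ℕ, qPochInf (a' * q ^ n) q * qPochInf (b' * q ^ n) q =
      (1 + u * q ^ n + v * (q ^ n) ^ 2) *
        (qPochInf (a * q ^ n) q * qPochInf (b * q ^ n) q)) :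
    prodSum q a' b' = ∑' n, prodTerm q a b c q n + u * ∑' n, prodTerm q a b c (q ^ 2) n +
      v * ∑' n, prodTerm q a b c (q ^ 3) n := by
  have hz : ∀ k : ℕ, k ≠ 0 → ‖q ^ k‖ < 1 := fun k hk => by
    rw [norm_pow]; exact pow_lt_one₀ (norm_nonneg q) hq hk
  have h1 := (summable_prodTerm hq a b c hq).hasSum
  have h2 := (summable_prodTerm hq a b c (hz 2 two_ne_zero)).hasSum.mul_left u
  have h3 := (summable_prodTerm hq a b c (hz 3 three_ne_zero)).hasSum.mul_left v
  refine Eq.trans (tsum_congr fun n => ?_) ((h1.add h2).add h3).tsum_eq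
  simp only [prodTerm, hc]
  linear_combination (qPochInf (q * q ^ n) q * qPoch (c * q ^ n) q n * q ^ n) * h n

/-- With c = ab/q³, this rests on (c; q)_{2n} = (c; q)_n (cq^n; q)_n. -/
theorem prodTerm_eq_mul_STerm {q a b : ℂ} (hq : ‖q‖ < 1)
    (hqn : ∀ n : ℕ, q * q ^ n ≠ 1) (ha : ∀ n : ℕ, a * q ^ n ≠ 1) (hb : ∀ n : ℕ, b * q ^ n ≠ 1)
    (hc : ∀ n : ℕ, a * b / q ^ 3 * q ^ n ≠ 1) (n : ℕ) :
    prodTerm q a b (a * b / q ^ 3) (q ^ 2) n =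
      qPochInf q q * qPochInf a q * qPochInf b q * STerm q a b n := by
  rw [prodTerm, STerm, two_mul n, qPoch_add, qPochInf_eq_qPoch_mul q hq n,
    qPochInf_eq_qPoch_mul a hq n, qPochInf_eq_qPoch_mul b hq n]
  have h1 := qPoch_ne_zero hqn n
  have h2 := qPoch_ne_zero ha n
  have h3 := qPoch_ne_zero hb n
  have h4 := qPoch_ne_zero hc n
  field_simp
  ring

end PartialTheta

open PartialTheta in
theorem mainTheorem10 (q a b : ℂ) (hq0 : q ≠ 0) (hq1 : ‖q‖ < 1)
    (ha0 : a ≠ 0) (hb0 : b ≠ 0) (hab : a - b * q ≠ 0) (hba : b - a * q ≠ 0)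
    (ha : ∀ n : ℕ, a * q ^ n ≠ 1) (hb : ∀ n : ℕ, b * q ^ n ≠ 1)
    (hc : ∀ n : ℕ, a * b / q ^ 3 * q ^ n ≠ 1) :
    Summable (PartialTheta.thetaTerm q a) ∧
    Summable (PartialTheta.thetaTerm q b) ∧
    Summable (PartialTheta.STerm q a b) ∧
    (a * b - a ^ 2 * q - a * q ^ 2 + b * q ^ 3) / (b * (a - b * q) * (b - a * q))
          * PartialTheta.theta q a
        - (a * b - b ^ 2 * q - b * q ^ 2 + a * q ^ 3) / (a * (a - b * q) * (b - a * q))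
          * PartialTheta.theta q b
        + q ^ 2 * (a ^ 2 - b ^ 2) / (a * b * (a - b * q) * (b - a * q))
      = (a - b) / (a * b) * PartialTheta.S q a b := by
  have hqn : ∀ n : ℕ, q * q ^ n ≠ 1 := fun n h => by
    have h1 := congrArg norm h
    rw [norm_one] at h1
    linarith [norm_mul_pow_le q hq1 n]
  have hterm := prodTerm_eq_mul_STerm hq1 hqn ha hb hc
  have hP : qPochInf q q * qPochInf a q * qPochInf b q ≠ 0 :=
    mul_ne_zero (mul_ne_zero (qPochInf_ne_zero hq1 hqn) (qPochInf_ne_zero hq1 ha))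
      (qPochInf_ne_zero hq1 hb)
  have hsum : Summable (STerm q a b) := by
    rw [← summable_mul_left_iff hP]
    have hz : ‖q ^ 2‖ < 1 := by
      rw [norm_pow]; exact pow_lt_one₀ (norm_nonneg q) hq1 two_ne_zero
    exact (summable_prodTerm hq1 a b (a * b / q ^ 3) hz).congr hterm
  refine ⟨summable_thetaTerm hq1 a, summable_thetaTerm hq1 b, hsum, ?_⟩
  have hS : ∑' n, prodTerm q a b (a * b / q ^ 3) (q ^ 2) n = S q a b := by
    rw [S, ← tsum_mul_left]
    exact tsum_congr hterm
  have hI : ∀ x : ℂ, ∀ n : ℕ, qPochInf (x / q * q ^ n) q =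
      (1 - x / q * q ^ n) * qPochInf (x * q ^ n) q :=
    fun x n => qPochInf_step hq1 (by field_simp)
  have hI2 : ∀ x : ℂ, ∀ n : ℕ, qPochInf (x / q ^ 2 * q ^ n) q =
      (1 - x / q ^ 2 * q ^ n) * ((1 - x / q * q ^ n) * qPochInf (x * q ^ n) q) := by
    intro x n
    rw [← hI]
    exact qPochInf_step hq1 (by field_simp)
  have r1 := prodSum_eq_add_add hq1 (a := a) (b := b) (a' := a / q) (b' := b / q)
    (u := -(a + b) / q) (v := a * b / q ^ 2) (c := a * b / q ^ 3) (by field_simp)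
    (fun n => by rw [hI, hI]; field_simp; ring)
  have r2 := prodSum_eq_add_add hq1 (a := a) (b := b) (a' := a / q ^ 2) (b' := b)
    (u := -a * (1 + q) / q ^ 2) (v := a ^ 2 / q ^ 3) (c := a * b / q ^ 3) (by field_simp)
    (fun n => by rw [hI2]; field_simp; ring)
  have r3 := prodSum_eq_add_add hq1 (a := a) (b := b) (a' := a) (b' := b / q ^ 2)
    (u := -b * (1 + q) / q ^ 2) (v := b ^ 2 / q ^ 3) (c := a * b / q ^ 3) (by field_simp)
    (fun n => by rw [hI2]; field_simp; ring)
  have t1 : ∀ x : ℂ, theta q (x / q) = 1 - x / q * theta q x := fun x => by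
    rw [theta_eq_one_sub hq1 (x / q), div_mul_cancel₀ _ hq0]
  have t2 : ∀ x : ℂ, theta q (x / q ^ 2) = 1 - x / q ^ 2 * (1 - x / q * theta q x) := fun x => by
    rw [theta_eq_one_sub hq1 (x / q ^ 2), ← t1, show x / q ^ 2 * q = x / q by field_simp]
  rw [prodSum_eq_theta_mul_theta hq0 hq1, hS] at r1 r2 r3
  rw [t1, t1] at r1
  rw [t2] at r2 r3
  generalize theta q a = A at *
  generalize theta q b = B at *
  generalize S q a b = s at *
  generalize ∑' n, prodTerm q a b (a * b / q ^ 3) q n = M at *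
  generalize ∑' n, prodTerm q a b (a * b / q ^ 3) (q ^ 3) n = N at *
  clear hS hterm hsum hP t1 t2 hI hI2 hqn
  rw [mul_comm b q] at hab
  field_simp at r1 r2 r3 ⊢
  refine mul_left_cancel₀ hq0 ?_
  -- Before denominators are cleared, the weights are a² - b², b(b - qa), -a(a - qb). They cancel
  -- `M` and `N` and leave (a - b)(a - bq)(b - aq)/q² times `s`.
  linear_combination q * (a ^ 2 - b ^ 2) * r1 + b * (b - q * a) * r2 - a * (a - q * b) * r3
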